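/- Let $\mathbb F$ be a field, $d\ge 0$, and let $\mathcal A=\{H_{\alpha_i,a_i}\mid i\in[m]\}$ be a finite set of hyperplanes $H_{\alpha_i,a_i}=\{x\in\mathbb F^d:\alpha_i\cdot x=a_i\}$ with $\alpha_i\neq 0$. Assume that $\mathcal A$ is essential, i.e. $\alpha_1,\dots,\alpha_m$ span $\mathbb F^d$. Notation. For an arrangement $\mathcal B$ (a finite set of affine subspaces, possibly including the empty set) in an affine space $V$, $L(\mathcal B)$ is the set of all nonempty intersections of members of $\mathcal B$ (including $V$), ordered by reverse inclusion; $\chi(\mathcal B,t)=\sum_{X\in L(\mathcal B)}\mu(V,X)\,t^{\dim X}$, where $\mu$ is the Möbius function of $L(\mathcal B)$, with $\chi(\mathcal B,t)=0$ if $V\in\mathcal B$; for $X\in L(\mathcal B)$, $\mathcal B/X=\{H\cap X\ne\emptyset\mid H\in\mathcal B,\ X\not\subseteq H\}$, an arrangement in $X$; and $M(\mathcal B)=V\setminus\bigcup_{H\in\mathcal B}H$. Let $\mathcal A^o=\{H_{\alpha_i,0}\mid i\in[m]\}$. The induced adjoint arrangement $\tilde{\mathcal A}$ in $\mathbb F^{d+1}$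 consists of the linear hyperplanes $(v,-1)\cdot y=0$ for all points $v$ with $\{v\}\in L(\mathcal A)$, and $(u,0)\cdot y=0$ for all lines $\mathbb Fu\in L(\mathcal A^o)$, $u\ne0$. For $(\alpha,a)\in\mathbb F^{d+1}$ let $\mathcal A+H_{\alpha,a}=\mathcal A\cup\{H_{\alpha,a}\}$, where $H_{\alpha,a}=\{x\in\mathbb F^d:\alpha\cdot x=a\}$ ($\alpha=0$ is allowed). For a field extension $K/\mathbb F$, let $\mathcal A_K$ be the arrangement in $K^d$ given by the same equations, and for $X\in L(\tilde{\mathcal A})$ let $X_K\subseteq K^{d+1}$ be the $K$-span of $X$. (a) Let $\mathbb F=\mathbb F_q$ be finite. For each $X\in L(\tilde{\mathcal A})$ there is a polynomial $\chi(X,t)\in\mathbb Z[t]$ such that $\chi(\mathcal A+H_{\alpha,a},t)=\chi(X,t)$ for all $(\alpha,a)\in M(\tilde{\mathcal A}/X)$ and, more generally, for every field extension $K/\mathbb F$, $\chi(\mathcal A_K+H_{\alpha,a},t)=\chi(X,t)$ for all $(\alpha,a)\in M(\widetilde{\mathcal A_K}/X_K)$; the set $M(\widetilde{\mathcal A_K}/X_K)$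 is nonempty whenever $K$ is infinite, so that $\chi(X,t)$ is uniquely determined. (b) Let $\mathbb F=\mathbb R$ and let $\mathcal A$ be rational, i.e. each hyperplane of $\mathcal A$ has an equation $\alpha\cdot x=a$ with $(\alpha,a)\in\mathbb Z^{d}\times\mathbb Z$. For each $X\in L(\tilde{\mathcal A})$ the set $M(\tilde{\mathcal A}/X)$ is nonempty and $\chi(\mathcal A+H_{\alpha,a},t)$ is the same polynomial, denoted $\chi(X,t)$, for all $(\alpha,a)\in M(\tilde{\mathcal A}/X)$. In both cases (a) and (b), the following identity holds in $\mathbb Z[t]$: $$\sum_{X\in L(\tilde{\mathcal A})}\chi(\tilde{\mathcal A}/X,t)\,\chi(X,t)=t^d(t-1)\,\chi(\mathcal A,t).$$ -/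

import Mathlib

universe u

namespace HypArr

open Polynomial

section Equations

variable {F : Type*} [Field F] {ι : Type*} [Fintype ι]

/-- The affine hyperplane `H_{α,a} = {x | α ⬝ x = a}` in `F^ι`. It is a genuine hyperplane
when `α ≠ 0`; it is empty for `α = 0`, `a ≠ 0`, and the whole space for `α = 0`, `a = 0`. -/
def hyperplane (α : ι → F) (a : F) : AffineSubspace F (ι → F) where
  carrier := {x | α ⬝ᵥ x = a}
  smul_vsub_vadd_mem' := by
    intro c p q r hp hq hr
    change α ⬝ᵥ p = a at hp
    change α ⬝ᵥ q = a at hq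
    change α ⬝ᵥ r = a at hr
    change α ⬝ᵥ (c • (p - q) + r) = a
    simp [dotProduct_add, dotProduct_smul, dotProduct_sub, hp, hq, hr]

/-- A hyperplane arrangement: a finite collection of genuine affine hyperplanes. -/
def IsArrangement (A : Finset (AffineSubspace F (ι → F))) : Prop :=
  ∀ H ∈ A, ∃ α : ι → F, α ≠ 0 ∧ ∃ a : F, H = hyperplane α a

/-- `A` is essential: the normal vectors of its hyperplanes span the whole space. -/
def IsEssential (A : Finset (AffineSubspace F (ι → F))) : Prop :=
  Submodule.span F {α : ι → F | ∃ a : F, hyperplane α a ∈ A} = ⊤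

/-- A real arrangement is rational if each of its hyperplanes is given by an equation
with integer coefficients. -/
def IsRational (A : Finset (AffineSubspace ℝ (ι → ℝ))) : Prop :=
  ∀ H ∈ A, ∃ (α : ι → ℤ) (a : ℤ), H = hyperplane (fun i => (α i : ℝ)) (a : ℝ)

end Equations

section General

variable {F : Type*} [Field F] {ι : Type*}

open Classical in
/-- The intersection semi-lattice `L(A)` of an arrangement `A` in the affine space `V`:
all nonempty intersections of members of `A`, including `V` as the empty intersection. -/
noncomputable def interLattice (V : AffineSubspace F (ι → F))
    (A : Finset (AffineSubspace F (ι → F))) : Finset (AffineSubspace F (ι → F)) :=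
  {X ∈ A.powerset.image (fun B => V ⊓ B.inf id) | X ≠ ⊥}

theorem self_mem_interLattice {V : AffineSubspace F (ι → F)}
    (A : Finset (AffineSubspace F (ι → F))) (hV : V ≠ ⊥) : V ∈ interLattice V A := by
  classical
  simp only [interLattice, Finset.mem_filter, Finset.mem_image, Finset.mem_powerset]
  exact ⟨⟨∅, by simp, by simp⟩, hV⟩

open Classical in
/-- The Möbius function of a finite collection of affine subspaces
ordered by reverse inclusion. -/
noncomputable def moebius (L : Finset (AffineSubspace F (ι → F))) (X Y : L) : ℤ :=
  letI : LocallyFiniteOrder (L)ᵒᵈ := Fintype.toLocallyFiniteOrder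
  IncidenceAlgebra.mu ℤ (OrderDual.toDual X) (OrderDual.toDual Y)

open Classical in
/-- The characteristic polynomial `χ(A,t) = ∑_{X ∈ L(A)} μ(V,X) t^{dim X}` of an arrangement `A`
in the nonempty affine space `V`, with the convention that it is `0` if `V ∈ A`. -/
noncomputable def charPoly (V : AffineSubspace F (ι → F))
    (A : Finset (AffineSubspace F (ι → F))) : ℤ[X] :=
  if h : V ≠ ⊥ ∧ V ∉ A then
    ∑ Y : interLattice V A,
      C (moebius (interLattice V A) ⟨V, self_mem_interLattice A h.1⟩ Y) *
        X ^ Module.finrank F (Y : AffineSubspace F (ι → F)).direction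
  else 0

open Classical in
/-- The restriction `A/Y = {H ∩ Y ≠ ∅ | H ∈ A, Y ⊄ H}`, an arrangement in `Y`. -/
noncomputable def restriction (A : Finset (AffineSubspace F (ι → F)))
    (Y : AffineSubspace F (ι → F)) : Finset (AffineSubspace F (ι → F)) :=
  {Z ∈ {H ∈ A | ¬ Y ≤ H}.image (fun H => H ⊓ Y) | Z ≠ ⊥}

/-- The complement `M(A) = V \ ⋃_{H ∈ A} H` of an arrangement in `V`. -/
def complement (V : AffineSubspace F (ι → F)) (A : Finset (AffineSubspace F (ι → F))) :
    Set (ι → F) :=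
  {x | x ∈ V ∧ ∀ H ∈ A, x ∉ H}

open Classical in
/-- The linearization `A°`: each `H_{α,a}` is replaced by the parallel linear hyperplane `H_{α,0}`,
which is the direction of `H_{α,a}`. -/
noncomputable def linearization (A : Finset (AffineSubspace F (ι → F))) :
    Finset (AffineSubspace F (ι → F)) :=
  A.image (fun H => H.direction.toAffineSubspace)

/-- Extension of scalars of an affine subspace of `F^ι` along a field extension `K / F`:
the `K`-affine span of its `F`-points (for `H_{α,a}` with `α ≠ 0`, the hyperplane of `K^ι` with
the same equation). -/
noncomputable def baseChange (K : Type*) [Field K] [Algebra F K]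
    (Y : AffineSubspace F (ι → F)) : AffineSubspace K (ι → K) :=
  affineSpan K ((fun x : ι → F => fun i => algebraMap F K (x i)) '' (Y : Set (ι → F)))

open Classical in
/-- An arrangement over `F`, regarded as an arrangement over an extension field `K`. -/
noncomputable def baseChangeArr (K : Type*) [Field K] [Algebra F K]
    (A : Finset (AffineSubspace F (ι → F))) : Finset (AffineSubspace K (ι → K)) :=
  A.image (baseChange K)

end General

section Adjoint

variable {F : Type*} [Field F] {d : ℕ}

/-- The vector `(α, a) ∈ F^{d+1}`. -/
def pair (α : Fin d → F) (a : F) : Fin (d + 1) → F :=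
  Fin.snoc (α := fun _ => F) α a

/-- The hyperplanes of the induced adjoint arrangement: `H_{(v,-1),0}` for the vertices `v` of `A`
(`{v}` a `0`-dimensional member of `L(A)`), and `H_{(u,0),0}` for the lines `F u` (`u ≠ 0`) that are
`1`-dimensional members of `L(A°)`. -/
def adjointSet (A : Finset (AffineSubspace F (Fin d → F))) :
    Set (AffineSubspace F (Fin (d + 1) → F)) :=
  {H | ∃ v : Fin d → F, AffineSubspace.mk' v ⊥ ∈ interLattice ⊤ A ∧
      H = hyperplane (pair v (-1)) 0} ∪
  {H | ∃ u : Fin d → F, u ≠ 0 ∧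
      (Submodule.span F {u}).toAffineSubspace ∈ interLattice ⊤ (linearization A) ∧
      H = hyperplane (pair u 0) 0}

theorem adjointSet_finite (A : Finset (AffineSubspace F (Fin d → F))) :
    (adjointSet A).Finite := by
  classical
  refine Set.Finite.union ?_ ?_
  · let f : AffineSubspace F (Fin d → F) → AffineSubspace F (Fin (d + 1) → F) := fun Z =>
      if h : ∃ v : Fin d → F, Z = AffineSubspace.mk' v ⊥ then
        hyperplane (pair h.choose (-1)) 0 else ⊥
    refine ((interLattice ⊤ A).finite_toSet.image f).subset ?_
    rintro H ⟨v, hv, rfl⟩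
    refine ⟨_, hv, ?_⟩
    have h : ∃ w : Fin d → F, AffineSubspace.mk' v ⊥ = AffineSubspace.mk' w (⊥ : Submodule F _) :=
      ⟨v, rfl⟩
    have hw : v = h.choose := by
      have h1 : v ∈ AffineSubspace.mk' v (⊥ : Submodule F (Fin d → F)) :=
        AffineSubspace.self_mem_mk' _ _
      rw [h.choose_spec, AffineSubspace.mem_mk'] at h1
      simpa [sub_eq_zero] using h1
    simp only [f, dif_pos h]
    rw [← hw]
  · let f : AffineSubspace F (Fin d → F) → AffineSubspace F (Fin (d + 1) → F) := fun Z =>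
      if h : ∃ u : Fin d → F, u ≠ 0 ∧ Z = (Submodule.span F {u}).toAffineSubspace then
        hyperplane (pair h.choose 0) 0 else ⊥
    refine ((interLattice ⊤ (linearization A)).finite_toSet.image f).subset ?_
    rintro H ⟨v, hv0, hv, rfl⟩
    refine ⟨_, hv, ?_⟩
    have h : ∃ w : Fin d → F, w ≠ 0 ∧ (Submodule.span F {v}).toAffineSubspace =
      (Submodule.span F {w}).toAffineSubspace := ⟨v, hv0, rfl⟩
    have h1 : h.choose ∈ Submodule.span F {v} :=
      (SetLike.ext_iff.1 h.choose_spec.2 h.choose).2 (Submodule.mem_span_singleton_self h.choose)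
    obtain ⟨c, hc⟩ := Submodule.mem_span_singleton.1 h1
    have hc0 : c ≠ 0 := by
      rintro rfl
      exact h.choose_spec.1 (by rw [← hc, zero_smul])
    have hp : pair h.choose 0 = c • pair v 0 := by
      rw [← hc]
      ext i
      refine Fin.lastCases ?_ (fun j => ?_) i <;> simp [pair]
    simp only [f, dif_pos h]
    rw [hp]
    ext x
    change (c • pair v 0) ⬝ᵥ x = 0 ↔ pair v 0 ⬝ᵥ x = 0
    simp [smul_dotProduct, hc0]

/-- The induced adjoint arrangement of `A`, a linear arrangement in `F^{d+1}`. -/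
noncomputable def adjoint (A : Finset (AffineSubspace F (Fin d → F))) :
    Finset (AffineSubspace F (Fin (d + 1) → F)) :=
  (adjointSet_finite A).toFinset

open Classical in
/-- The one-element extension `A + H_{α,a}`, as a function of the point `P = (α, a) ∈ F^{d+1}`. -/
noncomputable def oneExt (A : Finset (AffineSubspace F (Fin d → F))) (P : Fin (d + 1) → F) :
    Finset (AffineSubspace F (Fin d → F)) :=
  insert (hyperplane (fun i : Fin d => P i.castSucc) (P (Fin.last d))) A

/-- The stratum `M(Ã/Y) ⊆ F^{d+1}` of a flat `Y` of the induced adjoint arrangement `Ã`. -/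
def stratum (A : Finset (AffineSubspace F (Fin d → F)))
    (Y : AffineSubspace F (Fin (d + 1) → F)) : Set (Fin (d + 1) → F) :=
  complement Y (restriction (adjoint A) Y)

/-- `p` is the characteristic polynomial of every `A + H_{α,a}` with `(α,a)` in the stratum
of `Y`. -/
def IsCommonCharPoly (A : Finset (AffineSubspace F (Fin d → F)))
    (Y : AffineSubspace F (Fin (d + 1) → F)) (p : ℤ[X]) : Prop :=
  ∀ P ∈ stratum A Y, charPoly ⊤ (oneExt A P) = p

end Adjoint

end HypArr

/-! Whitney's theorem writes `χ(A + H_P)`, for `P = (α, a)`, as the sum over `B ⊆ A` of `(-1)^|B|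
(t^dim Z - t^dim (Z ∩ H_P))` with `Z = ⋂ B` (`charPoly_top_insert`). For nonempty `Z` of dimension
`k`, the bracket depends only on the position of `P` relative to two linear subspaces `C ⊆ E` of
`F^(d+1)`: `C = containingSpace Z` and `E = parallelSpace Z.direction`. It is `0` on `C`, `t^k` on
`E \ C`, where the intersection is empty, and `t^k - t^(k-1)` off `E`.

Essentiality makes `C` and `E` flats of the adjoint arrangement: `Z` contains a vertex `v`, its
direction is spanned by lines of `L(A°)`, and the conditions imposed on `P` by `v` and by these
lines are members of the adjoint. A point of the stratum of `Y` therefore lies in `C` or `E` exactly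
when `Y` does. This yields the explicit polynomial `strataPoly A Y`, which makes sense even if the
stratum has no points.

For the identity, exchange the sums and fix `Z`. As a function of `Y` the bracket is a combination
of the indicators of `Y ≤ ⊤`, `Y ≤ E` and `Y ≤ C`. Möbius inversion (`sum_charPoly_restriction`)
turns these into `t^(d+1)`, `t^(d+1-k)` and `t^(d-k)`. For `k > 0` the total is `t^(d+1) (t^k -
t^(k-1)) + t^d - t^d = t^d (t - 1) t^k`, with the same value for `k = 0`. Summing over `B` recovers
`χ(A)`.

Extension of scalars preserves intersections, dimensions and the containments in `C` and `E`, hence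
also `strataPoly`. -/

namespace HypArr

open Polynomial

/-! ### Möbius functions, Whitney's theorem and inversion over restrictions -/

section Moebius

variable {F : Type*} [Field F] {ι : Type*}

open Classical in
/-- The Möbius function of a finite collection of affine subspaces, extended by zero to all pairs
of affine subspaces. -/
noncomputable def moebiusExt (L : Finset (AffineSubspace F (ι → F)))
    (X Y : AffineSubspace F (ι → F)) : ℤ :=
  if h : X ∈ L ∧ Y ∈ L then moebius L ⟨X, h.1⟩ ⟨Y, h.2⟩ else 0

-- The lattice is ordered by reverse inclusion, so the interval from `X` to `Y` consists of the
-- members between `Y` and `X`.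
open Classical in
theorem sum_moebiusExt {L : Finset (AffineSubspace F (ι → F))} {X Y : AffineSubspace F (ι → F)}
    (hX : X ∈ L) (hY : Y ∈ L) :
    ∑ Z ∈ L with Y ≤ Z ∧ Z ≤ X, moebiusExt L Z Y = if X = Y then 1 else 0 := by
  let _ : LocallyFiniteOrder (L)ᵒᵈ := Fintype.toLocallyFiniteOrder
  have h := IncidenceAlgebra.sum_Icc_mu_left (𝕜 := ℤ)
    (OrderDual.toDual (⟨X, hX⟩ : L)) (OrderDual.toDual (⟨Y, hY⟩ : L))
  have h2 : (if (OrderDual.toDual (⟨X, hX⟩ : L)) = (OrderDual.toDual (⟨Y, hY⟩ : L))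
      then (1 : ℤ) else 0) = if X = Y then 1 else 0 := by
    congr 1
    simp
  rw [h2] at h
  rw [← h]
  refine Finset.sum_bij' (fun Z hZ => OrderDual.toDual (⟨Z, (Finset.mem_filter.1 hZ).1⟩ : L))
    (fun Z _ => (OrderDual.ofDual Z : L).1) ?_ ?_ ?_ ?_ ?_
  · intro Z hZ
    have := (Finset.mem_filter.1 hZ).2
    rw [Finset.mem_Icc]
    exact ⟨this.2, this.1⟩
  · intro Z hZ
    rw [Finset.mem_Icc] at hZ
    exact Finset.mem_filter.2 ⟨(OrderDual.ofDual Z).2, hZ.2, hZ.1⟩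
  · intro Z hZ
    rfl
  · intro Z hZ
    rfl
  · intro Z hZ
    have := (Finset.mem_filter.1 hZ).1
    simp only [moebiusExt, this, hY, and_self, dif_pos]
    rfl

/-- The Möbius function only depends on the elements between its arguments. -/
theorem moebiusExt_congr {L L' : Finset (AffineSubspace F (ι → F))}
    {V Y : AffineSubspace F (ι → F)} (h : ∀ Z ≤ V, Z ∈ L ↔ Z ∈ L') (hYL : Y ∈ L) :
    ∀ X ∈ L, Y ≤ X → X ≤ V → moebiusExt L X Y = moebiusExt L' X Y := by
  classical
  suffices H : ∀ X : L, Y ≤ X → (X : AffineSubspace F (ι → F)) ≤ V →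
      moebiusExt L X Y = moebiusExt L' X Y from fun X hX => H ⟨X, hX⟩
  intro X
  -- The defining recursion determines the value at `X` from those at the members strictly between,
  -- starting from `Y`.
  induction X using WellFoundedLT.induction with
  | ind X ih =>
  intro hYX hXV
  obtain ⟨X, hX⟩ := X
  have hf : L.filter (fun Z => Y ≤ Z ∧ Z ≤ X) = L'.filter (fun Z => Y ≤ Z ∧ Z ≤ X) := by
    ext Z
    simp only [Finset.mem_filter]
    refine and_congr_left fun hZ => h Z (hZ.2.trans hXV)
  have e1 := sum_moebiusExt hX hYL
  have e2 := sum_moebiusExt ((h X hXV).1 hX) ((h Y (hYX.trans hXV)).1 hYL)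
  rw [← e1, ← hf] at e2
  have hm : X ∈ L.filter (fun Z => Y ≤ Z ∧ Z ≤ X) := Finset.mem_filter.2 ⟨hX, hYX, le_rfl⟩
  rw [← Finset.add_sum_erase _ _ hm, ← Finset.add_sum_erase _ _ hm] at e2
  have e3 : ∑ Z ∈ (L.filter (fun Z => Y ≤ Z ∧ Z ≤ X)).erase X, moebiusExt L Z Y =
      ∑ Z ∈ (L.filter (fun Z => Y ≤ Z ∧ Z ≤ X)).erase X, moebiusExt L' Z Y := by
    refine Finset.sum_congr rfl fun Z hZ => ?_
    simp only [Finset.mem_erase, Finset.mem_filter] at hZ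
    exact ih ⟨Z, hZ.2.1⟩ (Subtype.mk_lt_mk.2 (lt_of_le_of_ne hZ.2.2.2 hZ.1))
      hZ.2.2.1 (hZ.2.2.2.trans hXV)
  rw [e3] at e2
  exact (add_right_cancel e2).symm

theorem mem_finset_inf {B : Finset (AffineSubspace F (ι → F))} {x : ι → F} :
    x ∈ B.inf id ↔ ∀ H ∈ B, x ∈ H := by
  classical
  induction B using Finset.induction_on with
  | empty => simp
  | insert H B _ ih => simp [Finset.inf_insert, AffineSubspace.mem_inf_iff, ih]

theorem mem_interLattice {V X : AffineSubspace F (ι → F)}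
    {A : Finset (AffineSubspace F (ι → F))} :
    X ∈ interLattice V A ↔ (∃ B ⊆ A, V ⊓ B.inf id = X) ∧ X ≠ ⊥ := by
  classical
  simp [interLattice]

theorem mem_interLattice_top {X : AffineSubspace F (ι → F)}
    {A : Finset (AffineSubspace F (ι → F))} :
    X ∈ interLattice ⊤ A ↔ (∃ B ⊆ A, B.inf id = X) ∧ X ≠ ⊥ := by
  simp [mem_interLattice]

/-- The monomial `t ^ dim Z`, which is `0` for the empty affine subspace. -/
noncomputable def dimMonomial (Z : AffineSubspace F (ι → F)) : ℤ[X] :=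
  open Classical in if Z = ⊥ then 0 else X ^ Module.finrank F Z.direction

theorem dimMonomial_of_ne_bot {Z : AffineSubspace F (ι → F)} (h : Z ≠ ⊥) :
    dimMonomial Z = X ^ Module.finrank F Z.direction := by
  simp [dimMonomial, h]

@[simp]
theorem dimMonomial_bot : dimMonomial (⊥ : AffineSubspace F (ι → F)) = 0 := by
  simp [dimMonomial]

theorem charPoly_eq_sum {V : AffineSubspace F (ι → F)} {A : Finset (AffineSubspace F (ι → F))}
    (hV : V ≠ ⊥) (hVA : V ∉ A) :
    charPoly V A = ∑ Y ∈ interLattice V A, C (moebiusExt (interLattice V A) V Y) *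
      X ^ Module.finrank F Y.direction := by
  rw [charPoly, dif_pos ⟨hV, hVA⟩, ← Finset.sum_coe_sort (interLattice V A)]
  refine Finset.sum_congr rfl fun Y _ => ?_
  rw [moebiusExt, dif_pos ⟨self_mem_interLattice A hV, Y.2⟩]

/-- The subfamilies `B` and `B ∪ {H}` have the same intersection with `H` and opposite signs. -/
theorem sum_powerset_inf_eq_zero {A : Finset (AffineSubspace F (ι → F))}
    {H : AffineSubspace F (ι → F)} (hH : H ∈ A) :
    ∑ B ∈ A.powerset, (-1 : ℤ[X]) ^ B.card * dimMonomial (B.inf id ⊓ H) = 0 := by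
  classical
  obtain ⟨A, hA, rfl⟩ : ∃ A', H ∉ A' ∧ insert H A' = A :=
    ⟨A.erase H, by simp, Finset.insert_erase hH⟩
  rw [Finset.sum_powerset_insert hA, ← Finset.sum_add_distrib]
  refine Finset.sum_eq_zero fun B hB => ?_
  have hHB : H ∉ B := fun h => hA (Finset.mem_powerset.1 hB h)
  have : (insert H B).inf id ⊓ H = B.inf id ⊓ H := by
    rw [Finset.inf_insert, id, inf_comm H, inf_assoc, inf_idem]
  rw [Finset.card_insert_of_notMem hHB, this]
  ring

open Classical in
/-- Whitney's theorem for the Möbius function of an intersection lattice. -/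
theorem moebiusExt_top_eq_sum {A : Finset (AffineSubspace F (ι → F))} (hA : ⊤ ∉ A)
    {X : AffineSubspace F (ι → F)} (hX : X ∈ interLattice ⊤ A) :
    moebiusExt (interLattice ⊤ A) ⊤ X =
      ∑ B ∈ A.powerset, (-1 : ℤ) ^ B.card * if B.inf id = X then 1 else 0 := by
  have htop : (⊤ : AffineSubspace F (ι → F)) ∈ interLattice ⊤ A :=
    self_mem_interLattice A (AffineSubspace.bot_ne_top F (ι → F) (ι → F)).symm
  have step : ∀ Z ∈ interLattice ⊤ A,
      ∑ B ∈ A.powerset with Z ≤ B.inf id, (-1 : ℤ) ^ B.card = if Z = ⊤ then 1 else 0 := by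
    intro Z hZ
    have : A.powerset.filter (fun B => Z ≤ B.inf id) = (A.filter (fun H => Z ≤ H)).powerset := by
      ext B
      simp only [Finset.mem_filter, Finset.mem_powerset, Finset.le_inf_iff, id,
        Finset.subset_iff]
      grind
    rw [this, Finset.sum_powerset_neg_one_pow_card]
    congr 1
    rw [eq_iff_iff, Finset.filter_eq_empty_iff]
    constructor
    · intro h
      obtain ⟨⟨B, hB, rfl⟩, -⟩ := mem_interLattice_top.1 hZ
      rcases B.eq_empty_or_nonempty with rfl | ⟨H, hH⟩
      · simp
      · exact absurd (Finset.inf_le hH) (h (hB hH))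
    · rintro rfl H hH h
      exact hA (top_le_iff.1 h ▸ hH)
  -- The indicator of `Z = ⊤` is replaced by the alternating sum from `step`. After exchanging sums,
  -- the Möbius recursion keeps only the `B` with intersection `X`.
  have e1 : moebiusExt (interLattice ⊤ A) ⊤ X =
      ∑ Z ∈ interLattice ⊤ A with X ≤ Z, moebiusExt (interLattice ⊤ A) Z X *
        if Z = ⊤ then 1 else 0 := by
    simp [htop]
  rw [e1, Finset.sum_congr rfl (fun Z hZ => by
    rw [← step Z (Finset.mem_filter.1 hZ).1, Finset.sum_filter, Finset.mul_sum])]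
  rw [Finset.sum_comm]
  refine Finset.sum_congr rfl fun B hB => ?_
  by_cases hbot : B.inf id = ⊥
  · have hXB : B.inf id ≠ X := fun h => (mem_interLattice_top.1 hX).2 (h ▸ hbot)
    rw [if_neg hXB, mul_zero]
    refine Finset.sum_eq_zero fun Z hZ => ?_
    rw [if_neg, mul_zero]
    rw [hbot, le_bot_iff]
    exact (mem_interLattice_top.1 (Finset.mem_filter.1 hZ).1).2
  · have hBL : B.inf id ∈ interLattice ⊤ A :=
      mem_interLattice_top.2 ⟨⟨B, Finset.mem_powerset.1 hB, rfl⟩, hbot⟩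
    rw [← sum_moebiusExt hBL hX, Finset.mul_sum, Finset.sum_filter, Finset.sum_filter]
    refine Finset.sum_congr rfl fun Z _ => ?_
    by_cases h₁ : X ≤ Z <;> by_cases h₂ : Z ≤ B.inf id <;> simp [h₁, h₂, mul_comm]

/-- Whitney's theorem: the characteristic polynomial as a sum over subarrangements. -/
theorem charPoly_top_eq_sum (A : Finset (AffineSubspace F (ι → F))) :
    charPoly ⊤ A = ∑ B ∈ A.powerset, (-1 : ℤ[X]) ^ B.card * dimMonomial (B.inf id) := by
  classical
  by_cases hA : ⊤ ∈ A
  · rw [charPoly, dif_neg (fun h => h.2 hA)]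
    simpa using (sum_powerset_inf_eq_zero hA).symm
  rw [charPoly_eq_sum (AffineSubspace.bot_ne_top F (ι → F) (ι → F)).symm hA]
  rw [Finset.sum_congr rfl (fun Y hY => by rw [moebiusExt_top_eq_sum hA hY, map_sum,
    Finset.sum_mul])]
  rw [Finset.sum_comm]
  refine Finset.sum_congr rfl fun B hB => ?_
  simp only [map_mul, map_pow, map_neg, map_one, mul_assoc]
  rw [← Finset.mul_sum]
  congr 1
  by_cases hbot : B.inf id = ⊥
  · rw [hbot, dimMonomial_bot]
    refine Finset.sum_eq_zero fun Z hZ => ?_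
    rw [if_neg (fun h => (mem_interLattice_top.1 hZ).2 h.symm)]
    simp
  · have hBL : B.inf id ∈ interLattice ⊤ A :=
      mem_interLattice_top.2 ⟨⟨B, Finset.mem_powerset.1 hB, rfl⟩, hbot⟩
    rw [Finset.sum_eq_single_of_mem _ hBL, dimMonomial_of_ne_bot hbot]
    · simp
    · intro Z _ hZ
      rw [if_neg hZ.symm]
      simp

/-- No assumption on `H` is needed: if `H ∈ A` the correction terms cancel in pairs, and for `H = ⊤`
every term vanishes, in agreement with the convention for `charPoly`. -/
theorem charPoly_top_insert [DecidableEq (AffineSubspace F (ι → F))]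
    (A : Finset (AffineSubspace F (ι → F))) (H : AffineSubspace F (ι → F)) :
    charPoly ⊤ (insert H A) = ∑ B ∈ A.powerset,
      (-1 : ℤ[X]) ^ B.card * (dimMonomial (B.inf id) - dimMonomial (B.inf id ⊓ H)) := by
  rw [charPoly_top_eq_sum]
  simp only [mul_sub, Finset.sum_sub_distrib]
  by_cases hH : H ∈ A
  · rw [sum_powerset_inf_eq_zero hH, sub_zero, Finset.insert_eq_of_mem hH]
  · rw [Finset.sum_powerset_insert hH, sub_eq_add_neg, ← Finset.sum_neg_distrib]
    congr 1
    refine Finset.sum_congr rfl fun B hB => ?_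
    have hHB : H ∉ B := fun h => hH (Finset.mem_powerset.1 hB h)
    rw [Finset.card_insert_of_notMem hHB, Finset.inf_insert, id, inf_comm]
    ring

open Classical in
/-- For an arrangement whose members have a common point, the characteristic polynomials of the
restrictions to the flats below a flat `E` add up to `t ^ dim E`. -/
theorem sum_charPoly_restriction {A : Finset (AffineSubspace F (ι → F))} {p : ι → F}
    (hp : ∀ H ∈ A, p ∈ H) {E : AffineSubspace F (ι → F)} (hE : E ∈ interLattice ⊤ A) :
    ∑ Y ∈ interLattice ⊤ A with Y ≤ E, charPoly Y (restriction A Y) =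
      X ^ Module.finrank F E.direction := by
  set L := interLattice ⊤ A with hL
  have hpL : ∀ Y ∈ L, p ∈ Y := by
    intro Y hY
    obtain ⟨⟨B, hB, rfl⟩, -⟩ := mem_interLattice_top.1 hY
    exact mem_finset_inf.2 fun H hH => hp H (hB hH)
  have hne : ∀ Y : AffineSubspace F (ι → F), p ∈ Y → Y ≠ ⊥ := by
    rintro Y h rfl
    exact AffineSubspace.notMem_bot F (ι → F) p h
  -- The common point `p` ensures that no trace `H ∩ Y` is discarded as empty.
  have hlat : ∀ Y ∈ L, ∀ Z ≤ Y, Z ∈ interLattice Y (restriction A Y) ↔ Z ∈ L := by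
    intro Y hY Z hZY
    have hpY := hpL Y hY
    obtain ⟨⟨B₀, hB₀, hB₀Y⟩, -⟩ := mem_interLattice_top.1 hY
    rw [mem_interLattice, hL, mem_interLattice_top]
    refine and_congr_left fun hZ => ⟨?_, ?_⟩
    · rintro ⟨B, hB, rfl⟩
      refine ⟨A.filter (fun H => Y ⊓ B.inf id ≤ H), Finset.filter_subset _ _, le_antisymm ?_ ?_⟩
      · intro x hx
        rw [mem_finset_inf] at hx
        have hxY : x ∈ Y := by
          rw [← hB₀Y, mem_finset_inf]
          exact fun H hH => hx H (Finset.mem_filter.2 ⟨hB₀ hH,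
            inf_le_left.trans (hB₀Y ▸ Finset.inf_le hH)⟩)
        refine (AffineSubspace.mem_inf_iff _ _ _).2 ⟨hxY, mem_finset_inf.2 fun H hH => ?_⟩
        have hHr := hB hH
        simp only [restriction, Finset.mem_filter, Finset.mem_image] at hHr
        obtain ⟨⟨H', ⟨hH'A, -⟩, rfl⟩, -⟩ := hHr
        refine (AffineSubspace.mem_inf_iff _ _ _).2 ⟨hx H' (Finset.mem_filter.2 ⟨hH'A, ?_⟩), hxY⟩
        exact inf_le_right.trans ((Finset.inf_le hH).trans inf_le_left)
      · exact Finset.le_inf fun H hH => (Finset.mem_filter.1 hH).2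
    · rintro ⟨B, hB, rfl⟩
      refine ⟨(B.filter (fun H => ¬ Y ≤ H)).image (fun H => H ⊓ Y), ?_, ?_⟩
      · intro H hH
        simp only [Finset.mem_image, Finset.mem_filter] at hH
        obtain ⟨H', ⟨hH'B, hYH'⟩, rfl⟩ := hH
        simp only [restriction, Finset.mem_filter, Finset.mem_image]
        exact ⟨⟨H', ⟨hB hH'B, hYH'⟩, rfl⟩, hne _
          ((AffineSubspace.mem_inf_iff _ _ _).2 ⟨hp _ (hB hH'B), hpY⟩)⟩
      · ext x
        simp only [AffineSubspace.mem_inf_iff, mem_finset_inf, Finset.mem_image,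
          Finset.mem_filter]
        constructor
        · rintro ⟨hxY, hx⟩ H hH
          by_cases hYH : Y ≤ H
          · exact hYH hxY
          · exact ((AffineSubspace.mem_inf_iff _ _ _).1 (hx _ ⟨H, ⟨hH, hYH⟩, rfl⟩)).1
        · intro hx
          have hxY : x ∈ Y := hZY (mem_finset_inf.2 hx)
          refine ⟨hxY, ?_⟩
          rintro _ ⟨H, ⟨hH, -⟩, rfl⟩
          exact (AffineSubspace.mem_inf_iff _ _ _).2 ⟨hx H hH, hxY⟩
  have hchar : ∀ Y ∈ L, charPoly Y (restriction A Y) =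
      ∑ Z ∈ L with Z ≤ Y, C (moebiusExt L Y Z) * X ^ Module.finrank F Z.direction := by
    intro Y hY
    have hYr : Y ∉ restriction A Y := by
      simp only [restriction, Finset.mem_filter, Finset.mem_image]
      rintro ⟨⟨H, ⟨-, h⟩, h'⟩, -⟩
      exact h (inf_eq_right.1 h')
    have hYb := hne Y (hpL Y hY)
    rw [charPoly_eq_sum hYb hYr]
    have hset : interLattice Y (restriction A Y) = L.filter (fun Z => Z ≤ Y) := by
      ext Z
      rw [Finset.mem_filter]
      constructor
      · intro h
        have hZY : Z ≤ Y := by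
          obtain ⟨⟨B, -, rfl⟩, -⟩ := mem_interLattice.1 h
          exact inf_le_left
        exact ⟨(hlat Y hY Z hZY).1 h, hZY⟩
      · exact fun h => (hlat Y hY Z h.2).2 h.1
    rw [← hset]
    refine Finset.sum_congr rfl fun Z hZ => ?_
    have hZ' := hset ▸ hZ
    rw [moebiusExt_congr (L' := L) (V := Y) (hlat Y hY) hZ Y
      (self_mem_interLattice _ hYb) (Finset.mem_filter.1 hZ').2 le_rfl]
  rw [Finset.sum_congr rfl (fun Y hY => by
    rw [hchar Y (Finset.mem_filter.1 hY).1, Finset.sum_filter])]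
  rw [Finset.sum_comm]
  -- With `Z` fixed, the Möbius values are summed over the interval between `Z` and `E`.
  have inner : ∀ Z ∈ L, (∑ Y ∈ L with Y ≤ E, if Z ≤ Y then
      C (moebiusExt L Y Z) * (X : ℤ[X]) ^ Module.finrank F Z.direction else 0) =
      if Z = E then X ^ Module.finrank F Z.direction else 0 := by
    intro Z hZ
    rw [← Finset.sum_filter, ← Finset.sum_mul, ← map_sum]
    have := sum_moebiusExt hE hZ
    rw [Finset.filter_filter]
    simp only [and_comm] at this ⊢
    rw [this]
    by_cases h : Z = E
    · simp [h]
    · simp [h, Ne.symm h]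
  rw [Finset.sum_congr rfl inner, Finset.sum_ite_eq' L E, if_pos hE]

end Moebius

/-! ### Vertices and lines of an essential arrangement -/

section Flats

variable {F : Type*} [Field F] {ι : Type*}

theorem inf_mem_interLattice {A : Finset (AffineSubspace F (ι → F))}
    {Z H : AffineSubspace F (ι → F)} (hZ : Z ∈ interLattice ⊤ A) (hH : H ∈ A) (h : Z ⊓ H ≠ ⊥) :
    Z ⊓ H ∈ interLattice ⊤ A := by
  classical
  obtain ⟨⟨B, hB, rfl⟩, -⟩ := mem_interLattice_top.1 hZ
  refine mem_interLattice_top.2 ⟨⟨insert H B, Finset.insert_subset hH hB, ?_⟩, h⟩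
  rw [Finset.inf_insert, id, inf_comm]

theorem ne_bot_of_mem {Z : AffineSubspace F (ι → F)} {z : ι → F} (hz : z ∈ Z) : Z ≠ ⊥ := by
  rintro rfl
  exact AffineSubspace.notMem_bot F (ι → F) z hz

theorem exists_mem_of_ne_bot {Z : AffineSubspace F (ι → F)} (hZ : Z ≠ ⊥) : ∃ z, z ∈ Z :=
  (AffineSubspace.nonempty_iff_ne_bot Z).2 hZ

theorem add_mem_iff_mem_direction {Z : AffineSubspace F (ι → F)} {z u : ι → F} (hz : z ∈ Z) :
    u + z ∈ Z ↔ u ∈ Z.direction :=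
  AffineSubspace.vadd_mem_iff_mem_direction u hz

theorem mem_direction_finset_inf {B : Finset (AffineSubspace F (ι → F))} {z u : ι → F}
    (hz : z ∈ B.inf id) : u ∈ (B.inf id).direction ↔ ∀ H ∈ B, u ∈ H.direction := by
  rw [← add_mem_iff_mem_direction hz, mem_finset_inf]
  exact forall₂_congr fun H hH => add_mem_iff_mem_direction (mem_finset_inf.1 hz H hH)

theorem direction_mem_interLattice_linearization {A : Finset (AffineSubspace F (ι → F))}
    {Z : AffineSubspace F (ι → F)} (hZ : Z ∈ interLattice ⊤ A) :
    Z.direction.toAffineSubspace ∈ interLattice ⊤ (linearization A) := by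
  classical
  obtain ⟨⟨B, hB, rfl⟩, hne⟩ := mem_interLattice_top.1 hZ
  obtain ⟨z, hz⟩ := exists_mem_of_ne_bot hne
  refine mem_interLattice_top.2 ⟨⟨B.image fun H => H.direction.toAffineSubspace, ?_, ?_⟩,
    ne_bot_of_mem (Submodule.mem_toAffineSubspace.2 (zero_mem _))⟩
  · exact Finset.image_subset_image hB
  · ext u
    rw [Submodule.mem_toAffineSubspace, mem_direction_finset_inf hz, mem_finset_inf]
    simp [Submodule.mem_toAffineSubspace]

theorem inf_direction_mem_interLattice_linearization {A : Finset (AffineSubspace F (ι → F))}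
    {W : Submodule F (ι → F)} (hW : W.toAffineSubspace ∈ interLattice ⊤ (linearization A))
    {H : AffineSubspace F (ι → F)} (hH : H ∈ A) :
    (W ⊓ H.direction).toAffineSubspace ∈ interLattice ⊤ (linearization A) := by
  classical
  have e : (W ⊓ H.direction).toAffineSubspace =
      W.toAffineSubspace ⊓ H.direction.toAffineSubspace := by
    ext x
    simp [Submodule.mem_toAffineSubspace, AffineSubspace.mem_inf_iff]
  rw [e]
  refine inf_mem_interLattice hW (Finset.mem_image_of_mem _ hH) ?_
  rw [← e]
  exact ne_bot_of_mem (Submodule.mem_toAffineSubspace.2 (zero_mem _))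

variable [Fintype ι]

theorem mem_hyperplane {α x : ι → F} {a : F} : x ∈ hyperplane α a ↔ α ⬝ᵥ x = a := Iff.rfl

theorem exists_dotProduct_eq {α u : ι → F} (h : α ⬝ᵥ u ≠ 0) (a : F) (z : ι → F) :
    ∃ c : F, α ⬝ᵥ (c • u + z) = a := by
  refine ⟨(a - α ⬝ᵥ z) / (α ⬝ᵥ u), ?_⟩
  rw [dotProduct_add, dotProduct_smul, smul_eq_mul, div_mul_cancel₀ _ h]
  ring

theorem mem_direction_hyperplane {α u : ι → F} (hu : α ⬝ᵥ u ≠ 0) {a : F} {x : ι → F} :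
    x ∈ (hyperplane α a).direction ↔ α ⬝ᵥ x = 0 := by
  obtain ⟨c, hc⟩ := exists_dotProduct_eq hu a 0
  rw [← add_mem_iff_mem_direction (mem_hyperplane.2 hc), mem_hyperplane, dotProduct_add, hc]
  simp

theorem IsEssential.exists_dotProduct_ne_zero {A : Finset (AffineSubspace F (ι → F))}
    (hA : IsEssential A) {u : ι → F} (hu : u ≠ 0) :
    ∃ (α : ι → F) (a : F), hyperplane α a ∈ A ∧ α ⬝ᵥ u ≠ 0 := by
  classical
  by_contra! h
  apply hu
  funext i
  have hi : (Pi.single i 1 : ι → F) ∈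
      Submodule.span F {α : ι → F | ∃ a : F, hyperplane α a ∈ A} := by
    rw [hA]
    trivial
  have key : ∀ α ∈ Submodule.span F {α : ι → F | ∃ a : F, hyperplane α a ∈ A}, α ⬝ᵥ u = 0 := by
    intro α hα
    induction hα using Submodule.span_induction with
    | mem α hα => exact h α hα.choose hα.choose_spec
    | zero => simp
    | add α β _ _ h1 h2 => rw [add_dotProduct, h1, h2, add_zero]
    | smul c α _ h => rw [smul_dotProduct, h, smul_zero]
  simpa using key _ hi

/-- Every flat of an essential arrangement contains a vertex. -/
theorem IsEssential.exists_vertex {A : Finset (AffineSubspace F (ι → F))}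
    (hA : IsEssential A) : ∀ {Z : AffineSubspace F (ι → F)}, Z ∈ interLattice ⊤ A →
      ∃ v ∈ Z, AffineSubspace.mk' v ⊥ ∈ interLattice ⊤ A := by
  intro Z hZ
  induction hn : Module.finrank F Z.direction using Nat.strong_induction_on generalizing Z with
  | _ n ih =>
  obtain ⟨z, hz⟩ := exists_mem_of_ne_bot (mem_interLattice_top.1 hZ).2
  by_cases hdir : Z.direction = ⊥
  · exact ⟨z, hz, by rwa [← hdir, AffineSubspace.mk'_eq hz]⟩
  · obtain ⟨u, huZ, hu⟩ := (Submodule.ne_bot_iff _).1 hdir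
    obtain ⟨α, a, hH, hαu⟩ := hA.exists_dotProduct_ne_zero hu
    obtain ⟨c, hc⟩ := exists_dotProduct_eq hαu a z
    have hmem : c • u + z ∈ Z ⊓ hyperplane α a := (AffineSubspace.mem_inf_iff _ _ _).2
      ⟨(add_mem_iff_mem_direction hz).2 (Submodule.smul_mem _ _ huZ), hc⟩
    -- Cutting by a hyperplane transversal to `u` stays nonempty and loses the direction `u`, so the
    -- induction descends to a point.
    have hlt : (Z ⊓ hyperplane α a).direction < Z.direction := by
      refine lt_of_le_of_ne (AffineSubspace.direction_le inf_le_left) fun h => hαu ?_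
      rw [← h, AffineSubspace.direction_inf_of_mem_inf hmem] at huZ
      exact (mem_direction_hyperplane hαu).1 huZ.2
    obtain ⟨v, hv, hvL⟩ := ih _ (hn ▸ Submodule.finrank_lt_finrank_of_lt hlt)
      (inf_mem_interLattice hZ hH (ne_bot_of_mem hmem)) rfl
    exact ⟨v, hv.1, hvL⟩

/-- Every flat of the linearization of an essential arrangement is spanned by the lines of the
intersection lattice that it contains. -/
theorem IsEssential.le_span_lines {A : Finset (AffineSubspace F (ι → F))}
    (hA : IsEssential A) : ∀ {W : Submodule F (ι → F)},
      W.toAffineSubspace ∈ interLattice ⊤ (linearization A) →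
      W ≤ Submodule.span F {u | u ≠ 0 ∧ u ∈ W ∧
        (Submodule.span F {u}).toAffineSubspace ∈ interLattice ⊤ (linearization A)} := by
  intro W hW
  induction hn : Module.finrank F W using Nat.strong_induction_on generalizing W with
  | _ n ih =>
  by_cases hbot : W = ⊥
  · simp [hbot]
  have cut : ∀ u ∈ W, ∀ (α : ι → F) (a : F), hyperplane α a ∈ A → α ⬝ᵥ u ≠ 0 →
      W ⊓ (hyperplane α a).direction ≤ Submodule.span F {u | u ≠ 0 ∧ u ∈ W ∧
        (Submodule.span F {u}).toAffineSubspace ∈ interLattice ⊤ (linearization A)} := by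
    intro u huW α a hH hαu
    have hlt : W ⊓ (hyperplane α a).direction < W := by
      refine lt_of_le_of_ne inf_le_left fun h => hαu ?_
      rw [← h] at huW
      exact (mem_direction_hyperplane hαu).1 huW.2
    refine (ih _ (hn ▸ Submodule.finrank_lt_finrank_of_lt hlt)
      (inf_direction_mem_interLattice_linearization hW hH) rfl).trans (Submodule.span_mono ?_)
    exact fun x hx => ⟨hx.1, hx.2.1.1, hx.2.2⟩
  obtain ⟨u, huW, hu⟩ := (Submodule.ne_bot_iff _).1 hbot
  obtain ⟨α, a, hH, hαu⟩ := hA.exists_dotProduct_ne_zero hu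
  have split : ∀ (β u' : ι → F) (b : F), β ⬝ᵥ u' ≠ 0 → u' ∈ W → ∀ w ∈ W, ∃ c : F,
      w - c • u' ∈ W ⊓ (hyperplane β b).direction := by
    intro β u' b hβ hu' w hw
    refine ⟨β ⬝ᵥ w / β ⬝ᵥ u', W.sub_mem hw (W.smul_mem _ hu'),
      (mem_direction_hyperplane hβ).2 ?_⟩
    rw [dotProduct_sub, dotProduct_smul, smul_eq_mul, div_mul_cancel₀ _ hβ, sub_self]
  -- Either `W` is itself a line, or it is the sum of two distinct hyperplane sections, each handled
  -- by `cut`.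
  by_cases h1 : W ⊓ (hyperplane α a).direction = ⊥
  · have hspan : Submodule.span F {u} = W := by
      refine le_antisymm (by simpa using huW) fun w hw => ?_
      obtain ⟨c, hc⟩ := split α u a hαu huW w hw
      rw [h1, Submodule.mem_bot, sub_eq_zero] at hc
      exact Submodule.mem_span_singleton.2 ⟨c, hc.symm⟩
    conv_lhs => rw [← hspan]
    exact Submodule.span_mono (Set.singleton_subset_iff.2 ⟨hu, huW, by rwa [hspan]⟩)
  · obtain ⟨u', hu'W, hu'⟩ := (Submodule.ne_bot_iff _).1 h1
    obtain ⟨β, b, hH', hβ⟩ := hA.exists_dotProduct_ne_zero hu'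
    intro w hw
    obtain ⟨c, hc⟩ := split β u' b hβ hu'W.1 w hw
    rw [← sub_add_cancel w (c • u')]
    exact add_mem (cut u' hu'W.1 β b hH' hβ hc)
      (Submodule.smul_mem _ _ (cut u huW α a hH hαu hu'W))

end Flats

/-! ### The contribution of one flat to the characteristic polynomial of an extension -/

section Weight

variable {F : Type*} [Field F] {d : ℕ}

/-- The normal vector `α` of the hyperplane encoded by `P = (α, a)`. -/
def normal (P : Fin (d + 1) → F) : Fin d → F := fun i => P i.castSucc

theorem pair_dotProduct (v : Fin d → F) (c : F) (P : Fin (d + 1) → F) :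
    pair v c ⬝ᵥ P = normal P ⬝ᵥ v + c * P (Fin.last d) := by
  simp [pair, normal, dotProduct, Fin.sum_univ_castSucc, mul_comm]

@[simp]
theorem normal_pair {R : Type*} (v : Fin d → R) (c : R) : normal (pair v c) = v := by
  funext i
  simp [normal, pair]

@[simp]
theorem pair_last {R : Type*} (v : Fin d → R) (c : R) : pair v c (Fin.last d) = c := by
  simp [pair]

/-- All `(α, a)` such that `α` vanishes on `W`. -/
def parallelSpace (W : Submodule F (Fin d → F)) : Submodule F (Fin (d + 1) → F) where
  carrier := {P | ∀ u ∈ W, normal P ⬝ᵥ u = 0}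
  add_mem' {P Q} hP hQ u hu := by
    change (normal P + normal Q) ⬝ᵥ u = 0
    rw [add_dotProduct, hP u hu, hQ u hu, add_zero]
  zero_mem' u _ := zero_dotProduct u
  smul_mem' c P hP u hu := by
    change (c • normal P) ⬝ᵥ u = 0
    rw [smul_dotProduct, hP u hu, smul_zero]

/-- All `(α, a)` such that `Z` is contained in the hyperplane `H_{α,a}`. -/
def containingSpace (Z : AffineSubspace F (Fin d → F)) : Submodule F (Fin (d + 1) → F) where
  carrier := {P | ∀ z ∈ Z, normal P ⬝ᵥ z = P (Fin.last d)}
  add_mem' {P Q} hP hQ u hu := by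
    change (normal P + normal Q) ⬝ᵥ u = P (Fin.last d) + Q (Fin.last d)
    rw [add_dotProduct, hP u hu, hQ u hu]
  zero_mem' u _ := zero_dotProduct u
  smul_mem' c P hP u hu := by
    change (c • normal P) ⬝ᵥ u = c • P (Fin.last d)
    rw [smul_dotProduct, hP u hu]

theorem mem_parallelSpace {W : Submodule F (Fin d → F)} {P : Fin (d + 1) → F} :
    P ∈ parallelSpace W ↔ ∀ u ∈ W, normal P ⬝ᵥ u = 0 := Iff.rfl

theorem mem_containingSpace_iff {Z : AffineSubspace F (Fin d → F)} {v : Fin d → F} (hv : v ∈ Z)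
    {P : Fin (d + 1) → F} : P ∈ containingSpace Z ↔
      P ∈ parallelSpace Z.direction ∧ normal P ⬝ᵥ v = P (Fin.last d) := by
  constructor
  · refine fun h => ⟨fun u hu => ?_, h v hv⟩
    have := h _ ((add_mem_iff_mem_direction hv).2 hu)
    rwa [dotProduct_add, h v hv, add_eq_right] at this
  · rintro ⟨h1, h2⟩ z hz
    have := h1 _ (AffineSubspace.vsub_mem_direction hz hv)
    rw [vsub_eq_sub, dotProduct_sub, sub_eq_zero] at this
    rw [this, h2]

theorem containingSpace_le_parallelSpace {Z : AffineSubspace F (Fin d → F)} (hZ : Z ≠ ⊥) :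
    containingSpace Z ≤ parallelSpace Z.direction := by
  obtain ⟨v, hv⟩ := exists_mem_of_ne_bot hZ
  exact fun P hP => ((mem_containingSpace_iff hv).1 hP).1

/-- The generic value of `t ^ dim Z - t ^ dim (Z ∩ H_{α,a})` for `(α, a) ∈ S`. -/
noncomputable def weight (Z : AffineSubspace F (Fin d → F)) (S : Set (Fin (d + 1) → F)) : ℤ[X] :=
  open Classical in
  if Z = ⊥ then 0
  else if S ⊆ containingSpace Z then 0
  else if S ⊆ parallelSpace Z.direction then X ^ Module.finrank F Z.direction
  else X ^ Module.finrank F Z.direction - X ^ (Module.finrank F Z.direction - 1)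

theorem finrank_inf_ker_add_one {V : Type*} [AddCommGroup V] [Module F V] [FiniteDimensional F V]
    {W : Submodule F V} {f : V →ₗ[F] F} {u : V} (hu : u ∈ W) (hf : f u ≠ 0) :
    Module.finrank F (W ⊓ LinearMap.ker f : Submodule F V) + 1 = Module.finrank F W := by
  have h := LinearMap.finrank_range_add_finrank_ker (f.domRestrict W)
  have hs : LinearMap.range (f.domRestrict W) = ⊤ := by
    refine LinearMap.range_eq_top.2 (LinearMap.surjective fun h0 => hf ?_)
    exact LinearMap.congr_fun h0 ⟨u, hu⟩
  have hk : Submodule.map W.subtype (LinearMap.ker (f.domRestrict W)) = W ⊓ LinearMap.ker f := by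
    ext x
    simp [and_comm]
  rw [hs, finrank_top, Module.finrank_self, add_comm] at h
  rw [← hk, Submodule.finrank_map_subtype_eq, h]

theorem dimMonomial_sub_dimMonomial_inf (Z : AffineSubspace F (Fin d → F))
    (P : Fin (d + 1) → F) :
    dimMonomial Z - dimMonomial (Z ⊓ hyperplane (normal P) (P (Fin.last d))) = weight Z {P} := by
  unfold weight
  by_cases hZ : Z = ⊥
  · simp [hZ]
  rw [if_neg hZ]
  obtain ⟨v, hv⟩ := exists_mem_of_ne_bot hZ
  split_ifs with h1 h2 <;> simp only [Set.singleton_subset_iff, SetLike.mem_coe] at h1 ⊢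
  · have : Z ≤ hyperplane (normal P) (P (Fin.last d)) := fun z hz => h1 z hz
    rw [inf_eq_left.2 this, sub_self]
  · have : Z ⊓ hyperplane (normal P) (P (Fin.last d)) = ⊥ := by
      by_contra hne
      obtain ⟨z, hz⟩ := exists_mem_of_ne_bot hne
      exact h1 ((mem_containingSpace_iff hz.1).2 ⟨h2 rfl, hz.2⟩)
    rw [this, dimMonomial_bot, sub_zero, dimMonomial_of_ne_bot hZ]
  · simp only [Set.singleton_subset_iff, SetLike.mem_coe, mem_parallelSpace, not_forall] at h2
    obtain ⟨u, huZ, hu⟩ := h2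
    obtain ⟨c, hc⟩ := exists_dotProduct_eq hu (P (Fin.last d)) v
    have hmem : c • u + v ∈ Z ⊓ hyperplane (normal P) (P (Fin.last d)) :=
      (AffineSubspace.mem_inf_iff _ _ _).2
        ⟨(add_mem_iff_mem_direction hv).2 (Submodule.smul_mem _ _ huZ), hc⟩
    have hdir : (Z ⊓ hyperplane (normal P) (P (Fin.last d))).direction =
        Z.direction ⊓ LinearMap.ker (dotProductEquiv F (Fin d) (normal P)) := by
      rw [AffineSubspace.direction_inf_of_mem_inf hmem]
      ext x
      simp [mem_direction_hyperplane hu]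
    have hr := finrank_inf_ker_add_one (f := dotProductEquiv F (Fin d) (normal P)) huZ hu
    rw [dimMonomial_of_ne_bot hZ, dimMonomial_of_ne_bot (ne_bot_of_mem hmem), hdir, ← hr,
      Nat.add_sub_cancel]

/-- The condition constrains only `α`, to the annihilator of `W`; the free coordinate `a` accounts
for the extra `1`. -/
theorem finrank_parallelSpace (W : Submodule F (Fin d → F)) :
    Module.finrank F (parallelSpace W) + Module.finrank F W = d + 1 := by
  let Φ : (Fin (d + 1) → F) →ₗ[F] Module.Dual F W :=
    (LinearMap.dualMap W.subtype).comp
      ((dotProductEquiv F (Fin d)).toLinearMap.comp (LinearMap.funLeft F F Fin.castSucc))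
  have hΦ : ∀ P u, Φ P u = normal P ⬝ᵥ u.1 := fun P u => rfl
  have hker : LinearMap.ker Φ = parallelSpace W := by
    ext P
    rw [LinearMap.mem_ker, mem_parallelSpace]
    constructor
    · intro h u hu
      rw [← hΦ P ⟨u, hu⟩, h]
      rfl
    · intro h
      ext u
      rw [hΦ, h u.1 u.2]
      rfl
  have hrange : LinearMap.range Φ = ⊤ := by
    refine LinearMap.range_eq_top.2 fun g => ?_
    obtain ⟨g', hg'⟩ := LinearMap.exists_extend g
    obtain ⟨α, rfl⟩ := (dotProductEquiv F (Fin d)).surjective g'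
    refine ⟨pair α 0, ?_⟩
    ext u
    rw [hΦ, normal_pair, ← hg']
    rfl
  have h := LinearMap.finrank_range_add_finrank_ker Φ
  rw [hrange, hker, finrank_top, Subspace.dual_finrank_eq, Module.finrank_fin_fun] at h
  omega

/-- For `v ∈ Z`, this space is cut out of `parallelSpace Z.direction` by the functional `(v, -1)`,
which is nonzero there at `(0, 1)`. -/
theorem finrank_containingSpace {Z : AffineSubspace F (Fin d → F)} (hZ : Z ≠ ⊥) :
    Module.finrank F (containingSpace Z) + Module.finrank F Z.direction = d := by
  obtain ⟨v, hv⟩ := exists_mem_of_ne_bot hZ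
  have h1 : pair 0 1 ∈ parallelSpace Z.direction := fun u _ => by simp
  have h2 : dotProductEquiv F (Fin (d + 1)) (pair v (-1)) (pair 0 1) ≠ 0 := by
    simp [pair_dotProduct]
  have h3 : containingSpace Z = parallelSpace Z.direction ⊓
      LinearMap.ker (dotProductEquiv F (Fin (d + 1)) (pair v (-1))) := by
    ext P
    rw [mem_containingSpace_iff hv, Submodule.mem_inf, LinearMap.mem_ker,
      dotProductEquiv_apply_apply, pair_dotProduct, neg_one_mul, add_neg_eq_zero]
  have h4 := finrank_inf_ker_add_one h1 h2
  rw [← h3] at h4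
  have := finrank_parallelSpace Z.direction
  omega

end Weight

/-! ### Strata of the adjoint arrangement and the summation identity -/

section Strata

variable {F : Type*} [Field F] {d : ℕ}

theorem mem_adjoint {A : Finset (AffineSubspace F (Fin d → F))}
    {H : AffineSubspace F (Fin (d + 1) → F)} : H ∈ adjoint A ↔ H ∈ adjointSet A :=
  Set.Finite.mem_toFinset _

theorem zero_mem_of_mem_adjoint {A : Finset (AffineSubspace F (Fin d → F))}
    {H : AffineSubspace F (Fin (d + 1) → F)} (hH : H ∈ adjoint A) : 0 ∈ H := by
  rcases mem_adjoint.1 hH with ⟨v, -, rfl⟩ | ⟨u, -, -, rfl⟩ <;> exact dotProduct_zero _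

theorem zero_mem_of_mem_interLattice_adjoint {A : Finset (AffineSubspace F (Fin d → F))}
    {Y : AffineSubspace F (Fin (d + 1) → F)} (hY : Y ∈ interLattice ⊤ (adjoint A)) : 0 ∈ Y := by
  obtain ⟨⟨B, hB, rfl⟩, -⟩ := mem_interLattice_top.1 hY
  exact mem_finset_inf.2 fun H hH => zero_mem_of_mem_adjoint (hB hH)

/-- `parallelSpace Z.direction` is cut out by members of the adjoint arrangement. -/
theorem subset_parallelSpace {A : Finset (AffineSubspace F (Fin d → F))} (hA : IsEssential A)
    {Z : AffineSubspace F (Fin d → F)} (hZ : Z ∈ interLattice ⊤ A) {S : Set (Fin (d + 1) → F)}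
    (hS : ∀ H ∈ adjoint A, (parallelSpace Z.direction : Set (Fin (d + 1) → F)) ⊆ H → S ⊆ H) :
    S ⊆ parallelSpace Z.direction := by
  intro P hP u hu
  have hspan := hA.le_span_lines (direction_mem_interLattice_linearization hZ) hu
  clear hu
  induction hspan using Submodule.span_induction with
  | mem u h =>
    obtain ⟨hu0, huZ, huL⟩ := h
    have := hS (hyperplane (pair u 0) 0) (mem_adjoint.2 (Or.inr ⟨u, hu0, huL, rfl⟩)) ?_ hP
    · simpa [mem_hyperplane, pair_dotProduct] using this
    · intro Q hQ
      simpa [mem_hyperplane, pair_dotProduct] using hQ u huZ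
  | zero => exact dotProduct_zero _
  | add x y _ _ h1 h2 => rw [dotProduct_add, h1, h2, add_zero]
  | smul c x _ h => rw [dotProduct_smul, h, smul_zero]

/-- `containingSpace Z` is cut out by members of the adjoint arrangement. -/
theorem subset_containingSpace {A : Finset (AffineSubspace F (Fin d → F))} (hA : IsEssential A)
    {Z : AffineSubspace F (Fin d → F)} (hZ : Z ∈ interLattice ⊤ A) {S : Set (Fin (d + 1) → F)}
    (hS : ∀ H ∈ adjoint A, (containingSpace Z : Set (Fin (d + 1) → F)) ⊆ H → S ⊆ H) :
    S ⊆ containingSpace Z := by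
  obtain ⟨v, hv, hvL⟩ := hA.exists_vertex hZ
  intro P hP
  refine (mem_containingSpace_iff hv).2 ⟨subset_parallelSpace hA hZ (fun H hH h => hS H hH
    (subset_trans (containingSpace_le_parallelSpace (ne_bot_of_mem hv)) h)) hP, ?_⟩
  have := hS (hyperplane (pair v (-1)) 0) (mem_adjoint.2 (Or.inl ⟨v, hvL, rfl⟩)) ?_ hP
  · simpa [mem_hyperplane, pair_dotProduct, add_neg_eq_zero] using this
  · intro Q hQ
    simpa [mem_hyperplane, pair_dotProduct, add_neg_eq_zero] using hQ v hv

/-- The hypothesis says that `W` is closed: it is the intersection of all the adjoint hyperplanes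
containing it. -/
theorem toAffineSubspace_mem_interLattice_adjoint {A : Finset (AffineSubspace F (Fin d → F))}
    {W : Submodule F (Fin (d + 1) → F)}
    (hW : ∀ S : Set (Fin (d + 1) → F), (∀ H ∈ adjoint A, (W : Set (Fin (d + 1) → F)) ⊆ H → S ⊆ H) →
      S ⊆ W) : W.toAffineSubspace ∈ interLattice ⊤ (adjoint A) := by
  classical
  refine mem_interLattice_top.2 ⟨⟨(adjoint A).filter fun H => W.toAffineSubspace ≤ H,
    Finset.filter_subset _ _, le_antisymm ?_ ?_⟩,
    ne_bot_of_mem (Submodule.mem_toAffineSubspace.2 (zero_mem _))⟩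
  · exact hW _ fun H hH h P hP => mem_finset_inf.1 hP H (Finset.mem_filter.2 ⟨hH, h⟩)
  · exact Finset.le_inf fun H hH => (Finset.mem_filter.1 hH).2

/-- Otherwise `H ∩ Y`, nonempty because it contains `0`, would be a member of the restriction
passing through `P`. -/
theorem le_of_mem_stratum {A : Finset (AffineSubspace F (Fin d → F))}
    {Y H : AffineSubspace F (Fin (d + 1) → F)} (hY : 0 ∈ Y) {P : Fin (d + 1) → F}
    (hP : P ∈ stratum A Y) (hH : H ∈ adjoint A) (hPH : P ∈ H) : Y ≤ H := by
  classical
  by_contra h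
  refine hP.2 (H ⊓ Y) ?_ ((AffineSubspace.mem_inf_iff _ _ _).2 ⟨hPH, hP.1⟩)
  simp only [restriction, Finset.mem_filter, Finset.mem_image]
  exact ⟨⟨H, ⟨hH, h⟩, rfl⟩, ne_bot_of_mem
    ((AffineSubspace.mem_inf_iff _ _ _).2 ⟨zero_mem_of_mem_adjoint hH, hY⟩)⟩

theorem weight_congr {K : Type*} [Field K] {Z : AffineSubspace F (Fin d → F)}
    {Z' : AffineSubspace K (Fin d → K)} {S : Set (Fin (d + 1) → F)} {S' : Set (Fin (d + 1) → K)}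
    (h₀ : Z = ⊥ ↔ Z' = ⊥) (h₁ : S ⊆ containingSpace Z ↔ S' ⊆ containingSpace Z')
    (h₂ : S ⊆ parallelSpace Z.direction ↔ S' ⊆ parallelSpace Z'.direction)
    (hr : Module.finrank F Z.direction = Module.finrank K Z'.direction) :
    weight Z S = weight Z' S' := by
  classical
  rw [weight, weight, hr]
  exact if_congr h₀ rfl (if_congr h₁ rfl (if_congr h₂ rfl rfl))

/-- Both subspaces that decide the weight are intersections of adjoint hyperplanes, and a stratum
point lies only on those that contain all of `Y`. -/
theorem weight_singleton_eq {A : Finset (AffineSubspace F (Fin d → F))} (hA : IsEssential A)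
    {Y : AffineSubspace F (Fin (d + 1) → F)} (hY : 0 ∈ Y) {P : Fin (d + 1) → F}
    (hP : P ∈ stratum A Y) {Z : AffineSubspace F (Fin d → F)}
    (hZ : Z ∈ interLattice ⊤ A) : weight Z {P} = weight Z Y := by
  have h1 : ({P} : Set (Fin (d + 1) → F)) ⊆ containingSpace Z ↔
      (Y : Set (Fin (d + 1) → F)) ⊆ containingSpace Z := by
    rw [Set.singleton_subset_iff]
    exact ⟨fun h => subset_containingSpace hA hZ fun H hH hZH =>
      le_of_mem_stratum hY hP hH (hZH h), fun h => h hP.1⟩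
  have h2 : ({P} : Set (Fin (d + 1) → F)) ⊆ parallelSpace Z.direction ↔
      (Y : Set (Fin (d + 1) → F)) ⊆ parallelSpace Z.direction := by
    rw [Set.singleton_subset_iff]
    exact ⟨fun h => subset_parallelSpace hA hZ fun H hH hZH =>
      le_of_mem_stratum hY hP hH (hZH h), fun h => h hP.1⟩
  exact weight_congr Iff.rfl h1 h2 rfl

/-- The characteristic polynomial `χ(Y, t)` of the one-element extensions in the stratum of `Y`. -/
noncomputable def strataPoly (A : Finset (AffineSubspace F (Fin d → F)))
    (Y : AffineSubspace F (Fin (d + 1) → F)) : ℤ[X] :=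
  ∑ B ∈ A.powerset, (-1 : ℤ[X]) ^ B.card * weight (B.inf id) Y

@[simp]
theorem weight_bot (S : Set (Fin (d + 1) → F)) : weight ⊥ S = 0 := by
  simp [weight]

theorem isCommonCharPoly_strataPoly {A : Finset (AffineSubspace F (Fin d → F))}
    (hA : IsEssential A) {Y : AffineSubspace F (Fin (d + 1) → F)} (hY : 0 ∈ Y) :
    IsCommonCharPoly A Y (strataPoly A Y) := by
  classical
  intro P hP
  rw [oneExt, charPoly_top_insert, strataPoly]
  refine Finset.sum_congr rfl fun B hB => ?_
  congr 1
  refine (dimMonomial_sub_dimMonomial_inf _ P).trans ?_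
  by_cases hbot : B.inf id = ⊥
  · rw [hbot, weight_bot, weight_bot]
  · exact weight_singleton_eq hA hY hP
      (mem_interLattice_top.2 ⟨⟨B, Finset.mem_powerset.1 hB, rfl⟩, hbot⟩)

-- Rewriting the case distinction with indicators of lower sets in `Y` makes it summable by Möbius
-- inversion.
open Classical in
theorem weight_eq_add {Z : AffineSubspace F (Fin d → F)} (hZ : Z ≠ ⊥)
    (Y : AffineSubspace F (Fin (d + 1) → F)) :
    weight Z Y = (X ^ Module.finrank F Z.direction - X ^ (Module.finrank F Z.direction - 1)) +
      (if Y ≤ (parallelSpace Z.direction).toAffineSubspace then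
        X ^ (Module.finrank F Z.direction - 1) else 0) -
      (if Y ≤ (containingSpace Z).toAffineSubspace then
        X ^ Module.finrank F Z.direction else 0) := by
  have h1 : (Y : Set (Fin (d + 1) → F)) ⊆ containingSpace Z ↔
    Y ≤ (containingSpace Z).toAffineSubspace := Iff.rfl
  have h2 : (Y : Set (Fin (d + 1) → F)) ⊆ parallelSpace Z.direction ↔
    Y ≤ (parallelSpace Z.direction).toAffineSubspace := Iff.rfl
  have h3 : Y ≤ (containingSpace Z).toAffineSubspace →
      Y ≤ (parallelSpace Z.direction).toAffineSubspace := fun h =>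
    h.trans fun x hx => containingSpace_le_parallelSpace hZ hx
  rw [weight, if_neg hZ]
  simp only [h1, h2]
  by_cases hC : Y ≤ (containingSpace Z).toAffineSubspace
  · simp [hC, h3 hC]
  · by_cases hE : Y ≤ (parallelSpace Z.direction).toAffineSubspace <;> simp [hC, hE]

theorem sum_charPoly_mul_weight {A : Finset (AffineSubspace F (Fin d → F))}
    (hA : IsEssential A) {Z : AffineSubspace F (Fin d → F)} (hZ : Z ∈ interLattice ⊤ A) :
    ∑ Y ∈ interLattice ⊤ (adjoint A), charPoly Y (restriction (adjoint A) Y) * weight Z Y =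
      X ^ d * (X - 1) * X ^ Module.finrank F Z.direction := by
  classical
  have hne := (mem_interLattice_top.1 hZ).2
  have h0 : ∀ H ∈ adjoint A, (0 : Fin (d + 1) → F) ∈ H := fun H => zero_mem_of_mem_adjoint
  have hT := sum_charPoly_restriction h0 (self_mem_interLattice (adjoint A)
    (AffineSubspace.bot_ne_top F (Fin (d + 1) → F) (Fin (d + 1) → F)).symm)
  have hE := sum_charPoly_restriction h0 (toAffineSubspace_mem_interLattice_adjoint
    (W := parallelSpace Z.direction) fun S => subset_parallelSpace hA hZ)
  have hC := sum_charPoly_restriction h0 (toAffineSubspace_mem_interLattice_adjoint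
    (W := containingSpace Z) fun S => subset_containingSpace hA hZ)
  rw [Submodule.toAffineSubspace_direction] at hE hC
  rw [Finset.filter_true_of_mem (fun _ _ => le_top), AffineSubspace.direction_top, finrank_top,
    Module.finrank_fin_fun] at hT
  have e : ∀ Y ∈ interLattice ⊤ (adjoint A),
      charPoly Y (restriction (adjoint A) Y) * weight Z Y =
      charPoly Y (restriction (adjoint A) Y) *
        (X ^ Module.finrank F Z.direction - X ^ (Module.finrank F Z.direction - 1)) +
      (if Y ≤ (parallelSpace Z.direction).toAffineSubspace then
        charPoly Y (restriction (adjoint A) Y) else 0) * X ^ (Module.finrank F Z.direction - 1) -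
      (if Y ≤ (containingSpace Z).toAffineSubspace then
        charPoly Y (restriction (adjoint A) Y) else 0) * X ^ Module.finrank F Z.direction := by
    intro Y _
    rw [weight_eq_add hne]
    split_ifs <;> ring
  rw [Finset.sum_congr rfl e, Finset.sum_sub_distrib, Finset.sum_add_distrib, ← Finset.sum_mul,
    ← Finset.sum_mul, ← Finset.sum_mul, ← Finset.sum_filter, ← Finset.sum_filter, hT, hE, hC]
  clear hT hE hC e
  have d1 := finrank_parallelSpace Z.direction
  have d2 := finrank_containingSpace hne
  generalize Module.finrank F Z.direction = k at *
  generalize Module.finrank F (parallelSpace Z.direction) = e at *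
  generalize Module.finrank F (containingSpace Z) = c at *
  -- For `k = 0` truncated subtraction makes the generic term `1 - 1 = 0`; the parallel space is
  -- then everything, and `t^(d+1) - t^d` remains.
  rcases k with _ | k
  · obtain rfl : e = d + 1 := by omega
    obtain rfl : c = d := by omega
    simp
    ring
  · obtain rfl : d = c + (k + 1) := by omega
    obtain rfl : e = c + 1 := by omega
    rw [Nat.add_sub_cancel]
    ring

theorem sum_charPoly_mul_strataPoly {A : Finset (AffineSubspace F (Fin d → F))}
    (hA : IsEssential A) :
    ∑ Y ∈ interLattice ⊤ (adjoint A), charPoly Y (restriction (adjoint A) Y) * strataPoly A Y =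
      X ^ d * (X - 1) * charPoly ⊤ A := by
  simp only [strataPoly, Finset.mul_sum, charPoly_top_eq_sum A]
  rw [Finset.sum_comm]
  refine Finset.sum_congr rfl fun B hB => ?_
  simp only [mul_left_comm _ ((-1 : ℤ[X]) ^ B.card)]
  rw [← Finset.mul_sum]
  congr 1
  by_cases hbot : B.inf id = ⊥
  · simp [hbot]
  · rw [dimMonomial_of_ne_bot hbot]
    exact sum_charPoly_mul_weight hA
      (mem_interLattice_top.2 ⟨⟨B, Finset.mem_powerset.1 hB, rfl⟩, hbot⟩)

/-- A vector space over an infinite field is not a finite union of proper subspaces. -/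
theorem stratum_nonempty [Infinite F] (A : Finset (AffineSubspace F (Fin d → F)))
    {Y : AffineSubspace F (Fin (d + 1) → F)} (hY : 0 ∈ Y) : (stratum A Y).Nonempty := by
  classical
  have hdir : ∀ {H : AffineSubspace F (Fin (d + 1) → F)}, 0 ∈ H → ∀ x, x ∈ H.direction ↔ x ∈ H :=
    fun h x => by rw [← add_mem_iff_mem_direction h, add_zero]
  let s : Finset (Subspace F Y.direction) := ((adjoint A).filter fun H => ¬ Y ≤ H).image
    fun H => H.direction.comap Y.direction.subtype
  have hs : ⊤ ∉ s := by
    simp only [s, Finset.mem_image, Finset.mem_filter]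
    rintro ⟨H, ⟨hH, hYH⟩, h⟩
    refine hYH fun y hy => (hdir (zero_mem_of_mem_adjoint hH) y).1 ?_
    have : (⟨y, (hdir hY y).2 hy⟩ : Y.direction) ∈ H.direction.comap Y.direction.subtype := by
      rw [h]
      trivial
    exact this
  obtain ⟨x, hx⟩ := (Set.ne_univ_iff_exists_notMem _).1 (Subspace.biUnion_ne_univ_of_top_notMem hs)
  refine ⟨x, (hdir hY _).1 x.2, fun H hH hxH => hx ?_⟩
  simp only [restriction, Finset.mem_filter, Finset.mem_image] at hH
  obtain ⟨⟨H, hH, rfl⟩, -⟩ := hH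
  refine Set.mem_biUnion (Finset.mem_image_of_mem _ (Finset.mem_filter.2 hH)) ?_
  exact (hdir (zero_mem_of_mem_adjoint hH.1) _).2 hxH.1

end Strata

/-! ### Extension of scalars for affine subspaces -/

section BaseChange

variable {F : Type*} [Field F] {ι : Type*} (K : Type*) [Field K] [Algebra F K]

/-- The inclusion `F^ι → K^ι` for a field extension `K / F`. -/
def liftVec (x : ι → F) : ι → K := fun i => algebraMap F K (x i)

theorem liftVec_add (x y : ι → F) : liftVec K (x + y) = liftVec K x + liftVec K y := by
  funext i
  simp [liftVec]

theorem liftVec_sub (x y : ι → F) : liftVec K (x - y) = liftVec K x - liftVec K y := by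
  funext i
  simp [liftVec]

theorem liftVec_smul (c : F) (x : ι → F) : liftVec K (c • x) = algebraMap F K c • liftVec K x := by
  funext i
  simp [liftVec]

@[simp]
theorem liftVec_zero : liftVec K (0 : ι → F) = 0 := by
  funext i
  simp [liftVec]

theorem liftVec_mem_span {S : Set (ι → F)} {x : ι → F} (hx : x ∈ Submodule.span F S) :
    liftVec K x ∈ Submodule.span K (liftVec K '' S) := by
  induction hx using Submodule.span_induction with
  | mem x hx => exact Submodule.subset_span ⟨x, hx, rfl⟩
  | zero => simp
  | add x y _ _ hx hy => exact liftVec_add K x y ▸ add_mem hx hy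
  | smul c x _ hx => exact liftVec_smul K c x ▸ Submodule.smul_mem _ _ hx

theorem liftVec_mem_baseChange {Z : AffineSubspace F (ι → F)} {z : ι → F} (hz : z ∈ Z) :
    liftVec K z ∈ baseChange K Z :=
  mem_affineSpan K ⟨z, hz, rfl⟩

theorem baseChange_le_iff {Z : AffineSubspace F (ι → F)} {T : AffineSubspace K (ι → K)} :
    baseChange K Z ≤ T ↔ ∀ z ∈ Z, liftVec K z ∈ T := by
  rw [baseChange, affineSpan_le, Set.image_subset_iff]
  exact Iff.rfl

theorem baseChange_eq_bot_iff {Z : AffineSubspace F (ι → F)} : baseChange K Z = ⊥ ↔ Z = ⊥ := by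
  rw [baseChange, affineSpan_eq_bot, Set.image_eq_empty, AffineSubspace.coe_eq_bot_iff]

theorem direction_baseChange {Z : AffineSubspace F (ι → F)} (hZ : Z ≠ ⊥) :
    (baseChange K Z).direction =
      Submodule.span K (liftVec K '' (Z.direction : Set (ι → F))) := by
  obtain ⟨z, hz⟩ := exists_mem_of_ne_bot hZ
  apply le_antisymm
  · rw [baseChange, direction_affineSpan, vectorSpan_def, Submodule.span_le]
    rintro _ ⟨_, ⟨x, hx, rfl⟩, _, ⟨y, hy, rfl⟩, rfl⟩
    exact Submodule.subset_span
      ⟨x - y, AffineSubspace.vsub_mem_direction hx hy, liftVec_sub K x y⟩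
  · rw [Submodule.span_le]
    rintro _ ⟨u, hu, rfl⟩
    have := AffineSubspace.vsub_mem_direction
      (liftVec_mem_baseChange K ((add_mem_iff_mem_direction hz).2 hu))
      (liftVec_mem_baseChange K hz)
    rwa [vsub_eq_sub, ← liftVec_sub, add_sub_cancel_right] at this

variable [Fintype ι]

theorem liftVec_dotProduct (x y : ι → F) :
    liftVec K x ⬝ᵥ liftVec K y = algebraMap F K (x ⬝ᵥ y) := by
  simp [liftVec, dotProduct]

variable {K} in
theorem linearMap_liftVec_dotProduct (g : K →ₗ[F] F) (α : ι → F) (x : ι → K) :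
    g (liftVec K α ⬝ᵥ x) = α ⬝ᵥ fun i => g (x i) := by
  simp [liftVec, dotProduct, ← Algebra.smul_def]

theorem finrank_span_liftVec (W : Submodule F (ι → F)) :
    Module.finrank K (Submodule.span K (liftVec K '' (W : Set (ι → F)))) = Module.finrank F W := by
  let b := Module.finBasis F W
  have hli : LinearIndependent F fun i => (b i : ι → F) :=
    b.linearIndependent.map' W.subtype W.ker_subtype
  have hli' : LinearIndependent K fun i => algebraMap F K ∘ (b i : ι → F) :=
    linearIndependent_algebraMap_comp_iff.2 hli
  have hspan : Submodule.span F (Set.range fun i => (b i : ι → F)) = W := by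
    have := congrArg (Submodule.map W.subtype) b.span_eq
    rwa [Submodule.map_span, ← Set.range_comp, Submodule.map_top, Submodule.range_subtype] at this
  have : Submodule.span K (liftVec K '' (W : Set (ι → F))) =
      Submodule.span K (Set.range fun i => algebraMap F K ∘ (b i : ι → F)) := by
    apply le_antisymm
    · rw [Submodule.span_le]
      rintro _ ⟨x, hx, rfl⟩
      rw [SetLike.mem_coe, ← hspan] at hx
      have := liftVec_mem_span K hx
      rwa [← Set.range_comp] at this
    · refine Submodule.span_mono ?_
      rintro _ ⟨i, rfl⟩
      exact ⟨b i, (b i).2, rfl⟩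
  rw [this, finrank_span_eq_card hli', Fintype.card_fin]

/-- A system of linear equations over `F` and its solutions over an extension field. -/
theorem mem_baseChange_iff {Z : AffineSubspace F (ι → F)} {S : Set ((ι → F) × F)}
    (hZ : ∀ x, x ∈ Z ↔ ∀ s ∈ S, s.1 ⬝ᵥ x = s.2) (x : ι → K) :
    x ∈ baseChange K Z ↔ ∀ s ∈ S, liftVec K s.1 ⬝ᵥ x = algebraMap F K s.2 := by
  classical
  constructor
  · intro hx s hs
    refine mem_hyperplane.1 ((baseChange_le_iff K
      (T := hyperplane (liftVec K s.1) (algebraMap F K s.2))).2 (fun z hz => ?_) hx)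
    rw [mem_hyperplane, liftVec_dotProduct, (hZ z).1 hz s hs]
  · intro hx
    -- An `F`-linear retraction `K → F`, applied coordinatewise, turns the solution `x` over `K`
    -- into a solution `p` over `F`.
    obtain ⟨g, hg⟩ := LinearMap.exists_leftInverse_of_injective (Algebra.linearMap F K)
      (LinearMap.ker_eq_bot.2 (algebraMap F K).injective)
    have hg' : ∀ a, g (algebraMap F K a) = a := fun a => LinearMap.congr_fun hg a
    let p : ι → F := fun i => g (x i)
    have hp : p ∈ Z := (hZ p).2 fun s hs => by
      rw [← linearMap_liftVec_dotProduct, hx s hs, hg']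
    let y : ι → K := x - liftVec K p
    have hy : ∀ s ∈ S, liftVec K s.1 ⬝ᵥ y = 0 := by
      intro s hs
      rw [dotProduct_sub, hx s hs, liftVec_dotProduct, (hZ p).1 hp s hs, sub_self]
    -- Expanding the homogeneous solution `x - p` in an `F`-basis of `K` gives coefficient vectors
    -- that solve the homogeneous system over `F`.
    let b := Module.Basis.ofVectorSpace F K
    have hq : ∀ j, (fun i => b.coord j (y i)) ∈ Z.direction := by
      intro j
      rw [← add_mem_iff_mem_direction hp, hZ]
      intro s hs
      rw [dotProduct_add, ← linearMap_liftVec_dotProduct, hy s hs, map_zero, zero_add,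
        (hZ p).1 hp s hs]
    have hsum : y = ∑ j ∈ Finset.univ.biUnion (fun i => (b.repr (y i)).support),
        b j • liftVec K (fun i => b.coord j (y i)) := by
      funext i
      rw [Finset.sum_apply]
      conv_lhs => rw [← b.linearCombination_repr (y i), Finsupp.linearCombination_apply]
      rw [Finsupp.sum_of_support_subset _ (Finset.subset_biUnion_of_mem
        (fun i => (b.repr (y i)).support) (Finset.mem_univ i)) _ (by simp)]
      refine Finset.sum_congr rfl fun j _ => ?_
      simp [liftVec, Algebra.smul_def, mul_comm]
    have hyd : y ∈ (baseChange K Z).direction := by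
      rw [direction_baseChange K (ne_bot_of_mem hp), hsum]
      exact Submodule.sum_mem _ fun j _ => Submodule.smul_mem _ _
        (Submodule.subset_span ⟨_, hq j, rfl⟩)
    have := (add_mem_iff_mem_direction (liftVec_mem_baseChange K hp)).2 hyd
    rwa [sub_add_cancel] at this

theorem baseChange_hyperplane (α : ι → F) (a : F) :
    baseChange K (hyperplane α a) = hyperplane (liftVec K α) (algebraMap F K a) := by
  ext x
  rw [mem_baseChange_iff K (S := {(α, a)}) (fun x => by simp [mem_hyperplane])]
  simp [mem_hyperplane]

theorem liftVec_mem_baseChange_iff {Z : AffineSubspace F (ι → F)} {S : Set ((ι → F) × F)}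
    (hZ : ∀ x, x ∈ Z ↔ ∀ s ∈ S, s.1 ⬝ᵥ x = s.2) (x : ι → F) :
    liftVec K x ∈ baseChange K Z ↔ x ∈ Z := by
  rw [mem_baseChange_iff K hZ, hZ]
  refine forall₂_congr fun s _ => ?_
  rw [liftVec_dotProduct, (algebraMap F K).injective.eq_iff]

/-- A hyperplane is recovered as the set of `F`-points of its extension. Hence subfamilies of `A`
and of its base change correspond with equal cardinality. -/
theorem IsArrangement.baseChange_injOn {A : Finset (AffineSubspace F (ι → F))}
    (hA : IsArrangement A) : Set.InjOn (baseChange K) (A : Set (AffineSubspace F (ι → F))) := by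
  intro H hH H' hH' h
  obtain ⟨α, -, a, rfl⟩ := hA H hH
  obtain ⟨β, -, b, rfl⟩ := hA H' hH'
  have key : ∀ (γ : ι → F) (c : F) (x : ι → F),
      liftVec K x ∈ baseChange K (hyperplane γ c) ↔ x ∈ hyperplane γ c := fun γ c x =>
    liftVec_mem_baseChange_iff K (S := {(γ, c)}) (fun x => by simp [mem_hyperplane]) x
  ext x
  rw [← key α a, ← key β b, h]

theorem baseChange_finset_inf [DecidableEq (AffineSubspace K (ι → K))]
    {B : Finset (AffineSubspace F (ι → F))} (hB : IsArrangement B) :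
    (B.image (baseChange K)).inf id = baseChange K (B.inf id) := by
  have hS : ∀ x, x ∈ B.inf id ↔
      ∀ s ∈ {s : (ι → F) × F | hyperplane s.1 s.2 ∈ B}, s.1 ⬝ᵥ x = s.2 := by
    intro x
    rw [mem_finset_inf]
    constructor
    · exact fun h s hs => h _ hs
    · intro h H hH
      obtain ⟨α, -, a, rfl⟩ := hB H hH
      exact h (α, a) hH
  ext x
  rw [mem_baseChange_iff K hS, mem_finset_inf, Finset.forall_mem_image]
  constructor
  · intro h s hs
    have := h hs
    rwa [baseChange_hyperplane, mem_hyperplane] at this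
  · intro h H hH
    obtain ⟨α, -, a, rfl⟩ := hB H hH
    rw [baseChange_hyperplane, mem_hyperplane]
    exact h (α, a) hH

theorem IsEssential.baseChangeArr {A : Finset (AffineSubspace F (ι → F))} (hA : IsEssential A) :
    IsEssential (baseChangeArr K A) := by
  classical
  rw [IsEssential, eq_top_iff]
  have hle : Submodule.span K (liftVec K '' {α : ι → F | ∃ a : F, hyperplane α a ∈ A}) ≤
      Submodule.span K {α : ι → K | ∃ a : K, hyperplane α a ∈ HypArr.baseChangeArr K A} := by
    refine Submodule.span_mono ?_
    rintro _ ⟨α, ⟨a, ha⟩, rfl⟩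
    exact ⟨algebraMap F K a, Finset.mem_image.2 ⟨_, ha, baseChange_hyperplane K α a⟩⟩
  refine le_trans ?_ hle
  intro x _
  rw [pi_eq_sum_univ' x]
  refine Submodule.sum_mem _ fun i _ => Submodule.smul_mem _ _ ?_
  have h : liftVec K (Pi.single i (1 : F)) = Pi.single i (1 : K) := by
    funext j
    simp only [liftVec, Pi.single_apply]
    split_ifs <;> simp
  rw [← h]
  refine liftVec_mem_span K ?_
  rw [hA]
  trivial

end BaseChange

/-! ### Invariance of the stratum polynomials under field extension -/

section BaseChangeStrata

variable {F : Type*} [Field F] {d : ℕ} (K : Type*) [Field K] [Algebra F K]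

theorem normal_liftVec (P : Fin (d + 1) → F) : normal (liftVec K P) = liftVec K (normal P) := rfl

theorem weight_baseChange (Z : AffineSubspace F (Fin d → F))
    (Y : AffineSubspace F (Fin (d + 1) → F)) :
    weight (baseChange K Z) (baseChange K Y) = weight Z Y := by
  by_cases hZ : Z = ⊥
  · rw [hZ, (baseChange_eq_bot_iff K).2 rfl, weight_bot, weight_bot]
  have hdir := direction_baseChange K hZ
  refine weight_congr (baseChange_eq_bot_iff K) ⟨fun h P hP z hz => ?_, fun h => ?_⟩
    ⟨fun h P hP u hu => ?_, fun h => ?_⟩ (by rw [hdir, finrank_span_liftVec])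
  · have := h (liftVec_mem_baseChange K hP) _ (liftVec_mem_baseChange K hz)
    rw [normal_liftVec, liftVec_dotProduct] at this
    exact (algebraMap F K).injective this
  · have h1 : ∀ z ∈ Z, baseChange K Y ≤ hyperplane (pair (liftVec K z) (-1)) 0 := by
      intro z hz
      rw [baseChange_le_iff]
      intro P hP
      rw [mem_hyperplane, pair_dotProduct, normal_liftVec, liftVec_dotProduct, h hP z hz]
      simp [liftVec]
    intro P hP
    refine (baseChange_le_iff K (T := hyperplane (normal P) (P (Fin.last d)))).2 fun z hz => ?_
    have := h1 z hz hP
    rwa [mem_hyperplane, pair_dotProduct, neg_one_mul, add_neg_eq_zero] at this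
  · have := h (liftVec_mem_baseChange K hP) (liftVec K u)
      (hdir ▸ Submodule.subset_span ⟨u, hu, rfl⟩)
    rw [normal_liftVec, liftVec_dotProduct] at this
    exact (algebraMap F K).injective (this.trans (map_zero _).symm)
  · have h1 : ∀ u ∈ Z.direction, baseChange K Y ≤ hyperplane (pair (liftVec K u) 0) 0 := by
      intro u hu
      rw [baseChange_le_iff]
      intro P hP
      rw [mem_hyperplane, pair_dotProduct, normal_liftVec, liftVec_dotProduct, h hP u hu]
      simp
    intro P hP u hu
    rw [hdir] at hu
    induction hu using Submodule.span_induction with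
    | mem u hu =>
      obtain ⟨u, hu, rfl⟩ := hu
      have := h1 u hu hP
      rwa [mem_hyperplane, pair_dotProduct, zero_mul, add_zero] at this
    | zero => exact dotProduct_zero _
    | add x y _ _ h1 h2 => rw [dotProduct_add, h1, h2, add_zero]
    | smul c x _ h => rw [dotProduct_smul, h, smul_zero]

theorem strataPoly_baseChange {A : Finset (AffineSubspace F (Fin d → F))} (hA : IsArrangement A)
    (Y : AffineSubspace F (Fin (d + 1) → F)) :
    strataPoly (baseChangeArr K A) (baseChange K Y) = strataPoly A Y := by
  classical
  have hinj := hA.baseChange_injOn K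
  have harr : ∀ B ⊆ A, IsArrangement B := fun B hB H hH => hA H (hB hH)
  rw [strataPoly, strataPoly]
  symm
  refine Finset.sum_bij (fun B _ => B.image (baseChange K)) ?_ ?_ ?_ ?_
  · intro B hB
    rw [Finset.mem_powerset] at hB ⊢
    rw [baseChangeArr]
    exact Finset.image_subset_image hB
  · intro B hB B' hB' h
    rw [Finset.mem_powerset] at hB hB'
    refine Finset.coe_injective ((hinj.image_eq_image_iff (Finset.coe_subset.2 hB)
      (Finset.coe_subset.2 hB')).1 ?_)
    rw [← Finset.coe_image, ← Finset.coe_image, h]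
  · intro B hB
    rw [Finset.mem_powerset, baseChangeArr] at hB
    obtain ⟨B', hB', rfl⟩ := Finset.subset_image_iff.1 hB
    exact ⟨B', Finset.mem_powerset.2 (Finset.coe_subset.1 hB'), rfl⟩
  · intro B hB
    rw [Finset.mem_powerset] at hB
    rw [baseChange_finset_inf K (harr B hB), weight_baseChange,
      Finset.card_image_of_injOn (hinj.mono (Finset.coe_subset.2 hB))]

theorem isCommonCharPoly_baseChange {A : Finset (AffineSubspace F (Fin d → F))}
    (hA : IsArrangement A) (hess : IsEssential A) {Y : AffineSubspace F (Fin (d + 1) → F)}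
    (hY : 0 ∈ Y) :
    IsCommonCharPoly (baseChangeArr K A) (baseChange K Y) (strataPoly A Y) := by
  rw [← strataPoly_baseChange K hA]
  exact isCommonCharPoly_strataPoly (hess.baseChangeArr K)
    (liftVec_zero (F := F) K ▸ liftVec_mem_baseChange K hY)

end BaseChangeStrata

end HypArr

/-! ### The finite field and rational cases -/

theorem theorem2p3 (d : ℕ) :
    (∀ (F : Type u) [Field F] [Finite F] (A : Finset (AffineSubspace F (Fin d → F))),
      HypArr.IsArrangement A → HypArr.IsEssential A →
      ∃ χ : AffineSubspace F (Fin (d + 1) → F) → Polynomial ℤ,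
        (∀ Y ∈ HypArr.interLattice ⊤ (HypArr.adjoint A),
          HypArr.IsCommonCharPoly A Y (χ Y) ∧
          ∀ (K : Type u) [Field K] [Algebra F K],
            HypArr.IsCommonCharPoly (HypArr.baseChangeArr K A) (HypArr.baseChange K Y) (χ Y) ∧
            (Infinite K →
              (HypArr.stratum (HypArr.baseChangeArr K A) (HypArr.baseChange K Y)).Nonempty)) ∧
        ∑ Y ∈ HypArr.interLattice ⊤ (HypArr.adjoint A),
            HypArr.charPoly Y (HypArr.restriction (HypArr.adjoint A) Y) * χ Y =
          Polynomial.X ^ d * (Polynomial.X - 1) * HypArr.charPoly ⊤ A) ∧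
    (∀ A : Finset (AffineSubspace ℝ (Fin d → ℝ)),
      HypArr.IsArrangement A → HypArr.IsEssential A → HypArr.IsRational A →
      ∃ χ : AffineSubspace ℝ (Fin (d + 1) → ℝ) → Polynomial ℤ,
        (∀ Y ∈ HypArr.interLattice ⊤ (HypArr.adjoint A),
          HypArr.IsCommonCharPoly A Y (χ Y) ∧ (HypArr.stratum A Y).Nonempty) ∧
        ∑ Y ∈ HypArr.interLattice ⊤ (HypArr.adjoint A),
            HypArr.charPoly Y (HypArr.restriction (HypArr.adjoint A) Y) * χ Y =
          Polynomial.X ^ d * (Polynomial.X - 1) * HypArr.charPoly ⊤ A) := by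
  constructor
  · intro F _ _ A hA hess
    -- The witness is given by a formula rather than by choosing a point, since a stratum over a
    -- finite field may be empty.
    refine ⟨HypArr.strataPoly A, fun Y hY => ?_, HypArr.sum_charPoly_mul_strataPoly hess⟩
    have hY₀ := HypArr.zero_mem_of_mem_interLattice_adjoint hY
    refine ⟨HypArr.isCommonCharPoly_strataPoly hess hY₀, fun K _ _ =>
      ⟨HypArr.isCommonCharPoly_baseChange K hA hess hY₀, fun _ => HypArr.stratum_nonempty _ ?_⟩⟩
    exact HypArr.liftVec_zero (F := F) K ▸ HypArr.liftVec_mem_baseChange K hY₀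
  · intro A _ hess _
    refine ⟨HypArr.strataPoly A, fun Y hY => ?_, HypArr.sum_charPoly_mul_strataPoly hess⟩
    have hY₀ := HypArr.zero_mem_of_mem_interLattice_adjoint hY
    exact ⟨HypArr.isCommonCharPoly_strataPoly hess hY₀, HypArr.stratum_nonempty A hY₀⟩
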